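/- Let $\mathcal G=\overline{\mathbb Q}^\times/\operatorname{Tor}(\overline{\mathbb Q}^\times)$, a $\mathbb Q$-vector space written multiplicatively, on which $G=\operatorname{Gal}(\overline{\mathbb Q}/\mathbb Q)$ acts, and let $\delta(\beta)=\#\{\sigma\beta:\sigma\in G\}$ for $\beta\in\mathcal G$. Let $K\subset\overline{\mathbb Q}$ be a finite Galois extension of $\mathbb Q$ with set of places $M_K$, and let $V_K\subset\mathcal G$ be the $\mathbb Q$-subspace spanned by the classes of elements of $K^\times$. For $v\in M_K$ let $\|\cdot\|_v$ be the absolute value extending the usual one of $\mathbb Q$ below $v$; it extends to $V_K$ by $\|\beta^r\|_v=\|\beta\|_v^r$ for $r\in\mathbb Q$. For $\beta\in V_K$ let $$h_1(\beta)=\sum_{v\in M_K}\frac{[K_v:\mathbb Q_v]}{[K:\mathbb Q]}\,\bigl|\log\|\beta\|_v\bigr| .$$ Let $\alpha\in V_K$, and let $S\subset M_K$ consist of the archimedean places of $K$, the places $v$ with $\|\alpha\|_v\neq1$, and all conjugates of these under $\operatorname{Gal}(K/\mathbb Q)$, which acts on places by $\|\cdot\|_{\sigma v}=\|\sigma^{-1}(\cdot)\|_v$.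 Put $V_{K,S}=\{\beta\in V_K:\|\beta\|_v=1\text{ for all }v\in M_K\setminus S\}$. Then $S$ is finite, contains all archimedean places and is stable under $\operatorname{Gal}(K/\mathbb Q)$, and there exists a $\mathbb Q$-linear projection $P_S:V_K\to V_{K,S}$ (that is, $P_S\beta=\beta$ for all $\beta\in V_{K,S}$) such that for all $\beta\in V_K$: 1. $h_1(P_S\beta)\le h_1(\beta)$; 2. $\delta(P_S\beta)\le\delta(\beta)$, and thus $\delta(P_S\beta)h_1(P_S\beta)\le\delta(\beta)h_1(\beta)$. If moreover $V_{K,S}\neq\{1\}$, then $P_S$ has norm exactly one with respect to both $N=h_1$ and $N=\delta h_1$, that is, $1$ is the least constant $C\ge0$ such that $N(P_S\beta)\le C\,N(\beta)$ for all $\beta\in V_K$. -/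

import Mathlib

open NumberField

noncomputable section

/-- The group `𝒢` of nonzero algebraic numbers modulo torsion (roots of unity).  It is written
additively: the product of classes is `+`, and the power of a class to a rational exponent `r`
is `r • _`. -/
def AlgModTor : Type :=
  Additive ((AlgebraicClosure ℚ)ˣ ⧸ CommGroup.torsion (AlgebraicClosure ℚ)ˣ)

instance : AddCommGroup AlgModTor :=
  inferInstanceAs (AddCommGroup
    (Additive ((AlgebraicClosure ℚ)ˣ ⧸ CommGroup.torsion (AlgebraicClosure ℚ)ˣ)))

instance : IsAddTorsionFree AlgModTor :=
  inferInstanceAs (IsAddTorsionFree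
    (Additive ((AlgebraicClosure ℚ)ˣ ⧸ CommGroup.torsion (AlgebraicClosure ℚ)ˣ)))

/-- The class modulo torsion of a nonzero algebraic number. -/
def algClass : Additive (AlgebraicClosure ℚ)ˣ →+ AlgModTor :=
  MonoidHom.toAdditive (QuotientGroup.mk' (CommGroup.torsion (AlgebraicClosure ℚ)ˣ))

theorem algClass_surjective : Function.Surjective algClass :=
  QuotientGroup.mk'_surjective (CommGroup.torsion (AlgebraicClosure ℚ)ˣ)

theorem algClass_eq_zero_iff (a : (AlgebraicClosure ℚ)ˣ) :
    algClass (Additive.ofMul a) = 0 ↔ IsOfFinOrder a :=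
  QuotientGroup.eq_one_iff (N := CommGroup.torsion (AlgebraicClosure ℚ)ˣ) a

theorem AlgModTor.exists_nsmul_eq {n : ℕ} (hn : n ≠ 0) (x : AlgModTor) :
    ∃ y : AlgModTor, n • y = x := by
  obtain ⟨a, rfl⟩ := algClass_surjective x
  obtain ⟨z, hz⟩ := IsAlgClosed.exists_pow_nat_eq
    ((Additive.toMul a : (AlgebraicClosure ℚ)ˣ) : AlgebraicClosure ℚ) (Nat.pos_of_ne_zero hn)
  have hz0 : z ≠ 0 := by
    rintro rfl
    rw [zero_pow hn] at hz
    exact (Additive.toMul a).ne_zero hz.symm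
  refine ⟨algClass (Additive.ofMul (Units.mk0 z hz0)), ?_⟩
  rw [← map_nsmul]
  congr 1
  apply Additive.toMul.injective
  ext
  simpa using hz

theorem AlgModTor.exists_ratSMul (r : ℚ) (x : AlgModTor) :
    ∃ y : AlgModTor, r.den • y = r.num • x :=
  AlgModTor.exists_nsmul_eq r.den_ne_zero _

/-- The rational power: `r • x` is the unique `y` with `y ^ den r = x ^ num r`
(in multiplicative notation). -/
instance : SMul ℚ AlgModTor :=
  ⟨fun r x => (AlgModTor.exists_ratSMul r x).choose⟩

theorem AlgModTor.den_smul (r : ℚ) (x : AlgModTor) : (r.den : ℤ) • (r • x) = r.num • x := by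
  rw [natCast_zsmul]
  exact (AlgModTor.exists_ratSMul r x).choose_spec

theorem AlgModTor.zsmul_cancel {n : ℤ} (hn : n ≠ 0) {x y : AlgModTor} (h : n • x = n • y) :
    x = y :=
  zsmul_right_injective hn h

theorem AlgModTor.smul_eq_of {r : ℚ} {x y : AlgModTor} {m k : ℤ} (hm : m ≠ 0)
    (hr : r * m = k) (h : m • y = k • x) : r • x = y := by
  have hd : (r.den : ℤ) ≠ 0 := by exact_mod_cast r.den_ne_zero
  apply AlgModTor.zsmul_cancel (mul_ne_zero hm hd)
  have hk : m * r.num = r.den * k := by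
    have h1 : r * r.den = r.num := Rat.mul_den_eq_num r
    have : (m : ℚ) * r.num = r.den * k := by rw [← h1, ← hr]; ring
    exact_mod_cast this
  rw [mul_zsmul, AlgModTor.den_smul, ← mul_zsmul, hk, mul_comm m, mul_zsmul, mul_zsmul, h]

instance : Module ℚ AlgModTor where
  one_smul x := AlgModTor.smul_eq_of (m := 1) (k := 1) one_ne_zero (by norm_num) rfl
  mul_smul r s x := by
    have hr : (r.den : ℤ) ≠ 0 := by exact_mod_cast r.den_ne_zero
    have hs : (s.den : ℤ) ≠ 0 := by exact_mod_cast s.den_ne_zero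
    refine AlgModTor.smul_eq_of (m := r.den * s.den) (k := r.num * s.num)
      (mul_ne_zero hr hs) ?_ ?_
    · have h1 : r * r.den = r.num := Rat.mul_den_eq_num r
      have h2 : s * s.den = s.num := Rat.mul_den_eq_num s
      push_cast
      rw [← h1, ← h2]; ring
    · rw [mul_comm (r.den : ℤ), mul_zsmul, AlgModTor.den_smul, ← mul_zsmul, mul_comm, mul_zsmul,
        AlgModTor.den_smul, ← mul_zsmul]
  smul_zero r := AlgModTor.smul_eq_of (m := r.den) (k := r.num)
    (by exact_mod_cast r.den_ne_zero) (Rat.mul_den_eq_num r) (by simp)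
  smul_add r x y := AlgModTor.smul_eq_of (m := r.den) (k := r.num)
    (by exact_mod_cast r.den_ne_zero) (Rat.mul_den_eq_num r) (by
      rw [zsmul_add, AlgModTor.den_smul, AlgModTor.den_smul, zsmul_add])
  add_smul r s x := by
    have hr : (r.den : ℤ) ≠ 0 := by exact_mod_cast r.den_ne_zero
    have hs : (s.den : ℤ) ≠ 0 := by exact_mod_cast s.den_ne_zero
    refine AlgModTor.smul_eq_of (m := r.den * s.den) (k := s.den * r.num + r.den * s.num)
      (mul_ne_zero hr hs) ?_ ?_
    · have h1 : r * r.den = r.num := Rat.mul_den_eq_num r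
      have h2 : s * s.den = s.num := Rat.mul_den_eq_num s
      push_cast
      rw [← h1, ← h2]; ring
    · have h1 := AlgModTor.den_smul r x
      have h2 := AlgModTor.den_smul s x
      rw [zsmul_add, add_zsmul, mul_zsmul (s • x), h2, mul_comm (r.den : ℤ), mul_zsmul (r • x), h1,
        ← mul_zsmul, ← mul_zsmul]
  zero_smul x := AlgModTor.smul_eq_of (m := 1) (k := 0) one_ne_zero (by norm_num) (by simp)

/-- The action of `σ ∈ Gal(ℚ̄/ℚ)` on algebraic numbers modulo torsion. -/
def galAct (σ : AlgebraicClosure ℚ ≃ₐ[ℚ] AlgebraicClosure ℚ) : AlgModTor →+ AlgModTor :=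
  MonoidHom.toAdditive (QuotientGroup.map _ _
    (Units.map (σ : AlgebraicClosure ℚ →* AlgebraicClosure ℚ)) (CommGroup.le_comap_torsion _))

theorem galAct_algClass (σ : AlgebraicClosure ℚ ≃ₐ[ℚ] AlgebraicClosure ℚ)
    (a : (AlgebraicClosure ℚ)ˣ) :
    galAct σ (algClass (Additive.ofMul a)) =
      algClass (Additive.ofMul (Units.map (σ : AlgebraicClosure ℚ →* AlgebraicClosure ℚ) a)) :=
  rfl

/-- `δ(x)`, the number of elements in the orbit of `x` under `Gal(ℚ̄/ℚ)`. -/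
def orbitSize (x : AlgModTor) : ℕ :=
  (Set.range fun σ : AlgebraicClosure ℚ ≃ₐ[ℚ] AlgebraicClosure ℚ => galAct σ x).ncard

/-- The class modulo torsion of a nonzero element of the subfield `K` of `ℚ̄`. -/
def fieldClass (K : IntermediateField ℚ (AlgebraicClosure ℚ)) : Additive Kˣ →+ AlgModTor :=
  algClass.comp (MonoidHom.toAdditive (Units.map (K.val : K →* AlgebraicClosure ℚ)))

/-- `V_K`, the `ℚ`-vector space spanned by the classes of the nonzero elements of `K`. -/
def fieldSpan (K : IntermediateField ℚ (AlgebraicClosure ℚ)) : Submodule ℚ AlgModTor :=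
  Submodule.span ℚ (Set.range (fieldClass K))

theorem exists_nsmul_eq_fieldClass {K : IntermediateField ℚ (AlgebraicClosure ℚ)}
    (x : fieldSpan K) :
    ∃ (n : ℕ) (a : Additive Kˣ), n ≠ 0 ∧ n • (x : AlgModTor) = fieldClass K a := by
  obtain ⟨x, hx⟩ := x
  change ∃ (n : ℕ) (a : Additive Kˣ), n ≠ 0 ∧ n • x = fieldClass K a
  induction hx using Submodule.span_induction with
  | mem x h =>
    obtain ⟨a, rfl⟩ := h
    exact ⟨1, a, one_ne_zero, one_nsmul _⟩
  | zero => exact ⟨1, 0, one_ne_zero, by simp⟩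
  | add x y _ _ hx hy =>
    obtain ⟨n, a, hn, ha⟩ := hx
    obtain ⟨m, b, hm, hb⟩ := hy
    refine ⟨n * m, m • a + n • b, mul_ne_zero hn hm, ?_⟩
    rw [map_add, map_nsmul, map_nsmul, ← ha, ← hb, nsmul_add, ← mul_nsmul, ← mul_nsmul,
      mul_comm m n]
  | smul r x _ hx =>
    obtain ⟨n, a, hn, ha⟩ := hx
    refine ⟨n * r.den, r.num • a, mul_ne_zero hn r.den_ne_zero, ?_⟩
    rw [map_zsmul, ← ha, mul_comm, mul_nsmul, ← natCast_zsmul _ r.den, AlgModTor.den_smul]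
    simp only [← natCast_zsmul, ← mul_zsmul]
    rw [mul_comm]

section Places

variable (K : Type*) [Field K] [NumberField K]

/-- The set `M_K` of places of `K`: the archimedean and the non-archimedean ones. -/
abbrev Place : Type _ := InfinitePlace K ⊕ FinitePlace K

variable {K}

/-- Mathlib's absolute value representing a place.  For an archimedean place this is
`‖·‖_v`, extending the usual absolute value of `ℚ`; for a finite place it is `x ↦ N(v) ^ (-ord_v x)`,
which is `‖·‖_v ^ [K_v : ℚ_v]` for the absolute value `‖·‖_v` extending the `p`-adic one. -/
def Place.abv : Place K → AbsoluteValue K ℝ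
  | Sum.inl v => v.1
  | Sum.inr v => v.1

/-- The exponent to which `Place.abv` is to be raised to obtain `‖·‖_v ^ [K_v : ℚ_v]`: the local
degree for an archimedean place and `1` for a finite place. -/
def Place.weight : Place K → ℕ
  | Sum.inl v => v.mult
  | Sum.inr _ => 1

/-- `log |a|_v` for `a ∈ Kˣ`, where `|a|_v = ‖a‖_v ^ ([K_v : ℚ_v] / [K : ℚ])`. -/
def Place.logUnit (v : Place K) : Additive Kˣ →+ ℝ where
  toFun a := (v.weight : ℝ) / Module.finrank ℚ K * Real.log (v.abv (Additive.toMul a : Kˣ))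
  map_zero' := by simp
  map_add' a b := by
    rw [toMul_add, Units.val_mul, map_mul, Real.log_mul, mul_add]
    · exact (v.abv.ne_zero_iff).2 (Units.ne_zero _)
    · exact (v.abv.ne_zero_iff).2 (Units.ne_zero _)

end Places

section

variable {K : IntermediateField ℚ (AlgebraicClosure ℚ)} [NumberField K]

theorem Place.logUnit_eq_of_fieldClass_eq (v : Place K) {a b : Additive Kˣ}
    (h : fieldClass K a = fieldClass K b) : v.logUnit a = v.logUnit b := by
  rw [← sub_eq_zero, ← map_sub] at h ⊢
  obtain ⟨n, hn, h1⟩ := isOfFinOrder_iff_pow_eq_one.1 ((algClass_eq_zero_iff _).1 h)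
  have h2 : n • (a - b) = 0 := by
    apply Additive.toMul.injective
    apply Units.map_injective (f := (K.val : K →* AlgebraicClosure ℚ)) K.val.injective
    simpa using h1
  have h3 : n • v.logUnit (a - b) = 0 := by rw [← map_nsmul, h2, map_zero]
  exact (smul_eq_zero.1 h3).resolve_left hn.ne'

/-- `log |x|_v` for `x ∈ V_K` is `(1/n) log |a|_v`, for any `n ≥ 1` and `a ∈ Kˣ` such that
`x ^ n` is the class of `a`. -/
def Place.logAux (v : Place K) (x : fieldSpan K) : ℝ :=
  v.logUnit (exists_nsmul_eq_fieldClass x).choose_spec.choose /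
    (exists_nsmul_eq_fieldClass x).choose

theorem Place.logAux_eq (v : Place K) {x : fieldSpan K} {n : ℕ} {a : Additive Kˣ} (hn : n ≠ 0)
    (h : n • (x : AlgModTor) = fieldClass K a) : v.logAux x = v.logUnit a / n := by
  obtain ⟨hm, h'⟩ := (exists_nsmul_eq_fieldClass x).choose_spec.choose_spec
  unfold Place.logAux
  generalize (exists_nsmul_eq_fieldClass x).choose_spec.choose = b at *
  generalize (exists_nsmul_eq_fieldClass x).choose = m at *
  have h1 : fieldClass K (n • b) = fieldClass K (m • a) := by
    rw [map_nsmul, map_nsmul, ← h, ← h', ← mul_nsmul, ← mul_nsmul, mul_comm]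
  have h2 := v.logUnit_eq_of_fieldClass_eq h1
  rw [map_nsmul, map_nsmul, nsmul_eq_mul, nsmul_eq_mul] at h2
  have hn' : (n : ℝ) ≠ 0 := by exact_mod_cast hn
  have hm' : (m : ℝ) ≠ 0 := by exact_mod_cast hm
  rw [div_eq_div_iff hm' hn']
  linarith

/-- The `ℚ`-linear map `x ↦ log |x|_v` on `V_K`. -/
def Place.logAbs (v : Place K) : fieldSpan K →ₗ[ℚ] ℝ :=
  AddMonoidHom.toRatLinearMap <| AddMonoidHom.mk' v.logAux fun x y => by
    obtain ⟨n, a, hn, ha⟩ := exists_nsmul_eq_fieldClass x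
    obtain ⟨m, b, hm, hb⟩ := exists_nsmul_eq_fieldClass y
    have h : (n * m) • ((x + y : fieldSpan K) : AlgModTor) = fieldClass K (m • a + n • b) := by
      rw [map_add, map_nsmul, map_nsmul, ← ha, ← hb, Submodule.coe_add, nsmul_add, ← mul_nsmul,
        ← mul_nsmul, mul_comm m n]
    rw [v.logAux_eq (mul_ne_zero hn hm) h, v.logAux_eq hn ha, v.logAux_eq hm hb, map_add,
      map_nsmul, map_nsmul, nsmul_eq_mul, nsmul_eq_mul]
    have hn' : (n : ℝ) ≠ 0 := by exact_mod_cast hn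
    have hm' : (m : ℝ) ≠ 0 := by exact_mod_cast hm
    push_cast
    field_simp

theorem Place.logAbs_eq (v : Place K) {x : fieldSpan K} {n : ℕ} {a : Additive Kˣ} (hn : n ≠ 0)
    (h : n • (x : AlgModTor) = fieldClass K a) : v.logAbs x = v.logUnit a / n :=
  v.logAux_eq hn h

/-- The Weil height `h₁(x) = ∑_v |log |x|_v| = ∑_v [K_v : ℚ_v] / [K : ℚ] * |log ‖x‖_v|` of
`x ∈ V_K`; all but finitely many terms vanish. -/
def weilHeight (x : fieldSpan K) : ℝ :=
  ∑ᶠ v : Place K, |v.logAbs x|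

/-- The Mahler-type function `δ(x) h₁(x)` on `V_K`. -/
def mahlerHeight (x : fieldSpan K) : ℝ :=
  orbitSize (x : AlgModTor) * weilHeight x

/-- `IsConjPlace u v`: the place `u` is `σ v` for some `σ ∈ Gal(K/ℚ)`, where
`‖y‖_{σ v} = ‖σ⁻¹ y‖_v`. -/
def IsConjPlace (u v : Place K) : Prop :=
  ∃ σ : K ≃ₐ[ℚ] K, ∀ y : K, u.abv y = v.abv (σ⁻¹ y)

/-- The set of places of `K` consisting of the archimedean places, the support of `x` (the places
where `x` has nontrivial valuation), and the Galois conjugates of all these. -/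
def placeSet (x : fieldSpan K) : Set (Place K) :=
  {u | ∃ v : Place K, (v.isLeft ∨ v.logAbs x ≠ 0) ∧ IsConjPlace u v}

/-- `V_{K,S}`, the subspace of those `x ∈ V_K` with `‖x‖_v = 1` at all places `v ∉ S`. -/
def sUnitSpan (S : Set (Place K)) : Submodule ℚ (fieldSpan K) :=
  ⨅ v ∈ Sᶜ, LinearMap.ker v.logAbs

theorem mem_sUnitSpan {S : Set (Place K)} {x : fieldSpan K} :
    x ∈ sUnitSpan S ↔ ∀ v : Place K, v ∉ S → v.logAbs x = 0 := by
  simp [sUnitSpan]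

/-- `c` is the operator norm of `P` with respect to the function `N` on `V_K`: the least
constant `C ≥ 0` such that `N (P x) ≤ C * N x` for all `x`. -/
def IsOperatorNorm {S : Set (Place K)} (N : fieldSpan K → ℝ)
    (P : fieldSpan K →ₗ[ℚ] sUnitSpan S) (c : ℝ) : Prop :=
  IsLeast {C : ℝ | 0 ≤ C ∧ ∀ x : fieldSpan K, N (P x) ≤ C * N x} c

end

end

/-! The maps `Place.logAbs` embed `V_K` into the functions on `M_K`, and `weilHeight` is the L¹ norm
there. The aim is to delete the components of `x` at the places outside `S` without increasing this
norm.

For each finite place `w` there is an `e w` in `V_K` whose only finite place is `w` and whose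
archimedean logarithms are all nonnegative (`exists_logAbs_single`): a power of the prime is
principal by finiteness of the class group, and a unit, from Dirichlet's theorem, levels the
archimedean values of a high power of its generator. By the product formula the archimedean mass of
`e w` equals its mass at `w`. Subtracting the suitable rational multiple of `e w` for each `w`
outside `S` removes the mass of `x` at `w` and adds at most as much at infinity, so the height does
not grow (`exists_projection`).

Since `S` is Galois stable and the height is Galois invariant, averaging this projection over
`Gal(K/ℚ)` keeps these properties and makes it equivariant (`exists_equivariant_projection`). An
equivariant map sends orbits onto orbits, so `δ` does not grow. The norm is exactly one because
nonzero elements of `V_{K,S}` are fixed and, by Kronecker's theorem, have positive height. -/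

open NumberField

noncomputable section

/-! ### Galois action on the places of a number field. -/

section FinitePlaces

variable {K : Type*} [Field K] [NumberField K]

-- A finite absolute value of an integer is determined by the norm of the prime and its multiplicity
-- in the integer; `e` preserves both.
open Ideal IsDedekindDomain in
theorem FinitePlace.mk_comap_apply_int (e : 𝓞 K ≃+* 𝓞 K) (he : Function.Surjective (e : 𝓞 K →+* 𝓞 K))
    (v : HeightOneSpectrum (𝓞 K)) (x : 𝓞 K) :
    FinitePlace.mk (v.comap (e : 𝓞 K →+* 𝓞 K) he) (x : K) =
      FinitePlace.mk v ((e x : 𝓞 K) : K) := by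
  rcases eq_or_ne x 0 with rfl | hx
  · simp
  have hex : e x ≠ 0 := by simpa using hx
  have h1 := (FinitePlace.mk (v.comap (e : 𝓞 K →+* 𝓞 K) he)).apply_mul_absNorm_pow_eq_one hx
  have h2 := (FinitePlace.mk v).apply_mul_absNorm_pow_eq_one hex
  rw [FinitePlace.maximalIdeal_mk] at h1 h2
  have hc : ∀ I : Ideal (𝓞 K), I.comap (e : 𝓞 K →+* 𝓞 K) = I.map (e.symm : 𝓞 K →+* 𝓞 K) :=
    fun I => (Ideal.map_symm e).symm
  have h3 : multiplicity (v.asIdeal.comap (e : 𝓞 K →+* 𝓞 K)) (span {x}) =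
      multiplicity v.asIdeal (span {e x}) := by
    -- `multiplicity` is `emultiplicity` with `⊤` replaced by `1`, so it suffices to compare the
    -- latter.
    apply congrArg (WithTop.untopD 1)
    refine emultiplicity_eq_emultiplicity_iff.2 fun n => ?_
    rw [Ideal.dvd_span_singleton, Ideal.dvd_span_singleton, hc, ← Ideal.map_pow, ← hc,
      Ideal.mem_comap]
    rfl
  have h4 : absNorm (v.asIdeal.comap (e : 𝓞 K →+* 𝓞 K)) = absNorm v.asIdeal := by
    rw [absNorm_apply, absNorm_apply, Submodule.cardQuot_apply, Submodule.cardQuot_apply]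
    exact Nat.card_congr (Ideal.quotientEquiv _ _ e
      (Ideal.map_comap_of_surjective (e : 𝓞 K →+* 𝓞 K) e.surjective _).symm).toEquiv
  rw [HeightOneSpectrum.comap_asIdeal, h3, h4] at h1
  exact mul_right_cancel₀ (right_ne_zero_of_mul_eq_one h2) (h1.trans h2.symm)

/-- The image of a finite place under a field automorphism `σ`: `‖x‖_{σ w} = ‖σ⁻¹ x‖_w`. -/
def FinitePlace.conj (σ : K ≃ₐ[ℚ] K) (w : FinitePlace K) : FinitePlace K :=
  FinitePlace.mk (w.maximalIdeal.comap (RingOfIntegers.mapRingEquiv σ⁻¹.toRingEquiv : 𝓞 K →+* 𝓞 K)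
    (RingOfIntegers.mapRingEquiv σ⁻¹.toRingEquiv).surjective)

theorem FinitePlace.conj_apply (σ : K ≃ₐ[ℚ] K) (w : FinitePlace K) (x : K) :
    FinitePlace.conj σ w x = w (σ⁻¹ x) := by
  obtain ⟨a, b, -, rfl⟩ := IsFractionRing.div_surjective (𝓞 K) x
  rw [map_div₀, map_div₀, map_div₀]
  have h (a : 𝓞 K) : FinitePlace.conj σ w (algebraMap (𝓞 K) K a) =
      w (σ⁻¹ (algebraMap (𝓞 K) K a)) := by
    have := FinitePlace.mk_comap_apply_int (RingOfIntegers.mapRingEquiv σ⁻¹.toRingEquiv)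
      (RingOfIntegers.mapRingEquiv σ⁻¹.toRingEquiv).surjective w.maximalIdeal a
    rw [FinitePlace.mk_maximalIdeal] at this
    exact this
  rw [h, h]

/-- The Galois action on places: `‖x‖_{σ v} = ‖σ⁻¹ x‖_v`. -/
def Place.conj (σ : K ≃ₐ[ℚ] K) : Place K → Place K :=
  Sum.map (σ • ·) (FinitePlace.conj σ)

theorem Place.abv_conj (σ : K ≃ₐ[ℚ] K) (v : Place K) (x : K) :
    (v.conj σ).abv x = v.abv (σ⁻¹ x) := by
  cases v with
  | inl v => rfl
  | inr v => exact FinitePlace.conj_apply σ v x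

theorem Place.weight_conj (σ : K ≃ₐ[ℚ] K) (v : Place K) : (v.conj σ).weight = v.weight := by
  cases v with
  | inl v =>
    change (σ • v).mult = v.mult
    classical
    unfold InfinitePlace.mult
    exact if_congr InfinitePlace.isReal_smul_iff rfl rfl
  | inr v => rfl

/-- The value at 2 is 2 at an archimedean place and at most 1 at a finite one. -/
theorem InfinitePlace.ne_finitePlace_two (u : InfinitePlace K) (v : FinitePlace K) :
    u 2 ≠ v 2 := by
  intro h
  have h1 : u (2 : ℕ) = (2 : ℕ) := InfinitePlace.map_natCast u 2
  have h2 := HeightOneSpectrum.adicAbv_natCast_le_one K v.maximalIdeal 2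
  rw [← FinitePlace.norm_embedding, FinitePlace.norm_embedding_eq, Nat.cast_ofNat, ← h,
    ← Nat.cast_ofNat (R := K), h1] at h2
  norm_num at h2

/-- Reduces identities between places, such as the group action laws, to identities between absolute
values. -/
theorem Place.abv_injective : Function.Injective (Place.abv (K := K)) := by
  rintro (u | u) (v | v) h
  · exact congrArg _ (Subtype.ext h)
  · exact absurd (DFunLike.congr_fun h 2) (InfinitePlace.ne_finitePlace_two u v)
  · exact absurd (DFunLike.congr_fun h 2).symm (InfinitePlace.ne_finitePlace_two v u)
  · exact congrArg _ (Subtype.ext h)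

theorem Place.conj_conj (σ τ : K ≃ₐ[ℚ] K) (v : Place K) :
    (v.conj τ).conj σ = v.conj (σ * τ) := by
  apply Place.abv_injective
  ext x
  simp [Place.abv_conj]

theorem Place.conj_one (v : Place K) : v.conj 1 = v := by
  apply Place.abv_injective
  ext x
  simp [Place.abv_conj]

/-- The Galois action on places, as a permutation. -/
def Place.conjEquiv (σ : K ≃ₐ[ℚ] K) : Equiv.Perm (Place K) where
  toFun := Place.conj σ
  invFun := Place.conj σ⁻¹
  left_inv v := by simp [Place.conj_conj, Place.conj_one]
  right_inv v := by simp [Place.conj_conj, Place.conj_one]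

theorem Place.logUnit_conj (σ : K ≃ₐ[ℚ] K) (v : Place K) (a : Additive Kˣ) :
    (v.conj σ).logUnit a =
      v.logUnit (Additive.ofMul (Units.map (σ⁻¹ : K ≃ₐ[ℚ] K) (Additive.toMul a))) := by
  change _ / _ * Real.log _ = _ / _ * Real.log _
  rw [Place.abv_conj, Place.weight_conj]
  rfl

/-! ### Supports, the product formula and Kronecker's theorem. -/

theorem Place.logUnit_eq_zero_iff (v : Place K) (a : Additive Kˣ) :
    v.logUnit a = 0 ↔ v.abv (Additive.toMul a : Kˣ) = 1 := by
  have hw : (v.weight : ℝ) ≠ 0 := by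
    cases v with
    | inl v => exact_mod_cast v.mult_pos.ne'
    | inr v => exact one_ne_zero ∘ Nat.cast_eq_zero.1
  have hn : (Module.finrank ℚ K : ℝ) ≠ 0 := by exact_mod_cast Module.finrank_pos.ne'
  have ha : 0 < v.abv (Additive.toMul a : Kˣ) := v.abv.pos (Units.ne_zero _)
  change _ / _ * Real.log _ = 0 ↔ _
  constructor
  · intro h
    exact Real.eq_one_of_pos_of_log_eq_zero ha
      ((mul_eq_zero.1 h).resolve_left (div_ne_zero hw hn))
  · intro h
    rw [h, Real.log_one, mul_zero]

theorem Place.finite_support_logUnit (a : Additive Kˣ) :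
    {v : Place K | v.logUnit a ≠ 0}.Finite := by
  have h := FinitePlace.hasFiniteMulSupport (Units.ne_zero (Additive.toMul a))
  refine ((Set.finite_range Sum.inl).union (h.image Sum.inr)).subset ?_
  rintro (v | v) hv
  · exact Or.inl ⟨v, rfl⟩
  · exact Or.inr ⟨v, fun h => hv ((Place.logUnit_eq_zero_iff _ _).2 h), rfl⟩

/-- The product formula, restricted to elements with a single finite place in their support. -/
theorem Place.sum_logUnit_infinite (a : Additive Kˣ) (w : FinitePlace K)
    (h : ∀ u : FinitePlace K, u ≠ w → u (Additive.toMul a : Kˣ) = 1) :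
    ∑ v : InfinitePlace K, Place.logUnit (Sum.inl v : Place K) a =
      -Place.logUnit (Sum.inr w : Place K) a := by
  have h1 := prod_abs_eq_one (Units.ne_zero (Additive.toMul a))
  rw [finprod_eq_single _ w h] at h1
  have h2 := congrArg Real.log h1
  rw [Real.log_one, Real.log_mul, Real.log_prod] at h2
  · rw [eq_neg_iff_add_eq_zero]
    have h3 : ∀ v : InfinitePlace K, Place.logUnit (Sum.inl v : Place K) a =
      (Module.finrank ℚ K : ℝ)⁻¹ * Real.log (v (Additive.toMul a : Kˣ) ^ v.mult) := by
      intro v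
      rw [Real.log_pow]
      change _ / _ * Real.log _ = _
      rw [div_eq_inv_mul, mul_assoc]
      rfl
    have h4 : Place.logUnit (Sum.inr w : Place K) a =
        (Module.finrank ℚ K : ℝ)⁻¹ * Real.log (w (Additive.toMul a : Kˣ)) := by
      change ((1 : ℕ) : ℝ) / _ * Real.log _ = _
      rw [Nat.cast_one, one_div]
      rfl
    simp only [h3, h4]
    rw [← Finset.mul_sum, ← mul_add, h2, mul_zero]
  · intro v _
    exact pow_ne_zero _ ((map_ne_zero v).2 (Units.ne_zero _))
  · exact Finset.prod_ne_zero_iff.2 fun v _ =>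
      pow_ne_zero _ ((map_ne_zero v).2 (Units.ne_zero _))
  · exact (map_ne_zero w).2 (Units.ne_zero _)

/-- Kronecker's theorem. -/
theorem isOfFinOrder_of_logUnit_eq_zero (a : Kˣ)
    (h : ∀ v : Place K, v.logUnit (Additive.ofMul a) = 0) : IsOfFinOrder a := by
  have h1 : ∀ v : Place K, v.abv (a : K) = 1 := fun v => (v.logUnit_eq_zero_iff _).1 (h v)
  -- The finite places show that `a` is integral; the archimedean ones then put all its conjugates
  -- on the unit circle.
  have h2 : (a : K) ∈ (algebraMap (𝓞 K) K).range := by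
    apply IsDedekindDomain.HeightOneSpectrum.mem_integers_of_valuation_le_one
    intro v
    have h3 : FinitePlace.mk v (a : K) = 1 := h1 (Sum.inr (FinitePlace.mk v))
    rw [FinitePlace.mk_apply, FinitePlace.norm_embedding'] at h3
    rw [← WithZeroMulInt.toNNReal_le_one_iff (HeightOneSpectrum.one_lt_absNorm_nnreal v)]
    exact_mod_cast h3.le
  obtain ⟨b, hb⟩ := h2
  obtain ⟨n, hn, hx⟩ := Embeddings.pow_eq_one_of_norm_eq_one K ℂ (x := (a : K))
    (hb ▸ RingOfIntegers.isIntegral_coe b)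
    ((InfinitePlace.eq_iff_eq _ _).1 fun w => h1 (Sum.inl w))
  exact isOfFinOrder_iff_pow_eq_one.2 ⟨n, hn, Units.ext (by simpa using hx)⟩

/-! ### Elements supported at one finite place and at infinity. -/

theorem exists_log_eq_zmul (w : FinitePlace K) :
    ∃ L : ℝ, ∀ a : K, ∃ k : ℤ, Real.log (w a) = k * L := by
  refine ⟨Real.log (Ideal.absNorm w.maximalIdeal.asIdeal), fun a => ?_⟩
  rcases eq_or_ne a 0 with rfl | ha
  · exact ⟨0, by simp⟩
  rw [← FinitePlace.norm_embedding_eq, FinitePlace.norm_embedding',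
    WithZeroMulInt.toNNReal_neg_apply _ ((Valuation.ne_zero_iff _).2 ha)]
  exact ⟨_, by rw [NNReal.coe_zpow, Real.log_zpow]; rfl⟩

/-- The prime of `w` raised to the class number is principal; `a` is a generator. -/
theorem exists_int_of_finitePlace (w : FinitePlace K) :
    ∃ a : 𝓞 K, a ≠ 0 ∧ w a < 1 ∧ ∀ u : FinitePlace K, u ≠ w → u a = 1 := by
  have hp : w.maximalIdeal.asIdeal ≠ ⊥ := w.maximalIdeal.ne_bot
  set p := w.maximalIdeal.asIdeal with hpd
  have h0 : p ^ classNumber K ∈ nonZeroDivisors (Ideal (𝓞 K)) :=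
    mem_nonZeroDivisors_of_ne_zero (pow_ne_zero _ hp)
  have h1 : (p ^ classNumber K).IsPrincipal := by
    rw [← ClassGroup.mk0_eq_one_iff h0]
    have : (⟨p ^ classNumber K, h0⟩ : nonZeroDivisors (Ideal (𝓞 K))) =
      ⟨p, mem_nonZeroDivisors_of_ne_zero hp⟩ ^ classNumber K := rfl
    rw [this, map_pow, classNumber, pow_card_eq_one]
  obtain ⟨a, ha⟩ := h1.principal
  rw [Ideal.submodule_span_eq] at ha
  have ha0 : a ≠ 0 := by
    rintro rfl
    rw [Ideal.span_singleton_eq_bot.2 rfl] at ha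
    exact pow_ne_zero _ hp ha
  refine ⟨a, ha0, ?_, fun u hu => ?_⟩
  · rw [← FinitePlace.norm_embedding_eq, FinitePlace.norm_lt_one_iff_mem, ← hpd]
    exact Ideal.pow_le_self (classNumber_ne_zero K) (ha ▸ Ideal.mem_span_singleton_self a)
  · rw [← FinitePlace.norm_embedding_eq, FinitePlace.norm_eq_one_iff_notMem]
    intro hmem
    apply hu
    have h2 : p ^ classNumber K ≤ u.maximalIdeal.asIdeal := by
      rw [ha, Ideal.span_singleton_le_iff_mem]
      exact hmem
    have h3 : p ≤ u.maximalIdeal.asIdeal := Ideal.IsPrime.le_of_pow_le h2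
    apply FinitePlace.maximalIdeal_injective
    exact (IsDedekindDomain.HeightOneSpectrum.ext
      (w.maximalIdeal.isMaximal.eq_of_le u.maximalIdeal.isPrime.ne_top h3)).symm

-- By Dirichlet's theorem the units form a full lattice in the logarithmic space, which omits `w₀`.
-- Rounding down in a lattice basis moves a point by at most the sum of the norms of the basis
-- vectors.
open Units Units.dirichletUnitTheorem in
theorem exists_unit_log_near :
    ∃ C : ℝ, 0 ≤ C ∧ ∀ y : InfinitePlace K → ℝ, ∃ u : (𝓞 K)ˣ,
      ∀ v : InfinitePlace K, v ≠ w₀ → |v.mult * Real.log (v u) - y v| ≤ C := by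
  classical
  let b := (basisUnitLattice K).ofZLatticeBasis ℝ (unitLattice K)
  refine ⟨∑ i, ‖b i‖, Finset.sum_nonneg fun i _ => norm_nonneg _, fun y => ?_⟩
  let y' : logSpace K := fun v => y v
  obtain ⟨u, -, hu⟩ : (ZSpan.floor b y' : logSpace K) ∈ unitLattice K :=
    (Module.Basis.ofZLatticeBasis_span ℝ (unitLattice K) (basisUnitLattice K)).le
      (ZSpan.floor b y').2
  refine ⟨Additive.toMul u, fun v hv => ?_⟩
  have h2 := ZSpan.norm_fract_le b y'
  have h3 := (norm_le_pi_norm (ZSpan.fract b y') ⟨v, hv⟩).trans h2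
  rw [ZSpan.fract_apply, ← hu, Pi.sub_apply, norm_sub_rev] at h3
  exact h3

-- A unit can bring `m * l v` within `C` of the mean `m * T / N` at each `v ≠ w₀`. Unit logarithms
-- sum to zero, so the error at `w₀` is at most `(N - 1) * C`. For large `m` the mean exceeds both
-- errors.
open Units Units.dirichletUnitTheorem in
theorem exists_unit_log_add_nonneg (l : InfinitePlace K → ℝ) (hT : 0 < ∑ v, l v) :
    ∃ (m : ℕ) (u : (𝓞 K)ˣ), m ≠ 0 ∧
      ∀ v : InfinitePlace K, 0 ≤ v.mult * Real.log (v u) + m * l v := by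
  classical
  obtain ⟨C, hC0, hC⟩ := exists_unit_log_near (K := K)
  set T : ℝ := ∑ v, l v with hTd
  obtain ⟨N, hNd⟩ : ∃ N : ℝ, N = Fintype.card (InfinitePlace K) := ⟨_, rfl⟩
  have hN : 1 ≤ N := by
    rw [hNd]
    exact Nat.one_le_cast.2 (Fintype.card_pos (α := InfinitePlace K))
  obtain ⟨m, hm⟩ := exists_nat_gt (N * C / (T / N))
  rw [div_lt_iff₀ (by positivity)] at hm
  have hm0 : m ≠ 0 := by
    rintro rfl
    have : 0 ≤ N * C := by positivity
    simp at hm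
    linarith
  obtain ⟨u, hu⟩ := hC fun v => m * (T / N - l v)
  refine ⟨m, u, hm0, fun v => ?_⟩
  have hsum : ∑ v : {v : InfinitePlace K // v ≠ w₀}, (v.1.mult * Real.log (v.1 u)) =
      -(w₀ : InfinitePlace K).mult * Real.log ((w₀ : InfinitePlace K) u) :=
    sum_logEmbedding_component u
  have hTs : T = l w₀ + ∑ v : {v : InfinitePlace K // v ≠ w₀}, l v :=
    Fintype.sum_eq_add_sum_subtype_ne _ w₀
  have hNs : N = 1 + ∑ v : {v : InfinitePlace K // v ≠ w₀}, (1 : ℝ) := by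
    rw [← Fintype.sum_eq_add_sum_subtype_ne (fun _ : InfinitePlace K => (1 : ℝ)) w₀, hNd]
    simp
  by_cases hv : v = w₀
  · subst hv
    have h1 : ∑ v : {v : InfinitePlace K // v ≠ w₀}, (v.1.mult * Real.log (v.1 u)) ≤
        ∑ v : {v : InfinitePlace K // v ≠ w₀}, ((m * (T / N) + C) * 1 - m * l v) :=
      Finset.sum_le_sum fun v _ => by
        have := (abs_le.1 (hu v.1 v.2)).2
        linarith
    rw [Finset.sum_sub_distrib, ← Finset.mul_sum, ← Finset.mul_sum, hsum,
      eq_sub_of_add_eq' hNs.symm, eq_sub_of_add_eq' hTs.symm] at h1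
    have h2 : m * (T / N) * N = m * T := by field_simp
    nlinarith
  · have := (abs_le.1 (hu v hv)).1
    nlinarith

/-- Every finite place `w` is the only finite place in the support of some element of `K` all of
whose archimedean absolute values are at least `1`. -/
theorem exists_unit_of_finitePlace (w : FinitePlace K) :
    ∃ a : Kˣ, (∀ v : InfinitePlace K, 0 ≤ Real.log (v a)) ∧ w a < 1 ∧
      ∀ u : FinitePlace K, u ≠ w → u a = 1 := by
  obtain ⟨a, ha0, ha1, ha2⟩ := exists_int_of_finitePlace w
  have haK : (a : K) ≠ 0 := RingOfIntegers.coe_ne_zero_iff.2 ha0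
  -- The product formula turns `w a < 1` into a positive archimedean sum.
  have hT : 0 < ∑ v : InfinitePlace K, v.mult * Real.log (v a) := by
    have h1 := prod_abs_eq_one haK
    rw [finprod_eq_single _ w ha2] at h1
    have h2 := congrArg Real.log h1
    have hw : 0 < w (a : K) := FinitePlace.pos_iff.2 haK
    rw [Real.log_one, Real.log_mul _ hw.ne', Real.log_prod] at h2
    · simp only [Real.log_pow] at h2
      linarith [Real.log_neg hw ha1]
    · exact fun v _ => pow_ne_zero _ ((map_ne_zero v).2 haK)
    · exact Finset.prod_ne_zero_iff.2 fun v _ => pow_ne_zero _ ((map_ne_zero v).2 haK)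
  obtain ⟨m, u, hm0, key⟩ := exists_unit_log_add_nonneg _ hT
  have huK : (u : K) ≠ 0 := Units.coe_ne_zero u
  have hfin : ∀ v : FinitePlace K, v (u : K) = 1 := by
    intro v
    rw [← FinitePlace.norm_embedding_eq]
    rw [FinitePlace.norm_eq_one_iff_notMem]
    exact fun h => v.maximalIdeal.isPrime.ne_top (Ideal.eq_top_of_isUnit_mem _ h u.isUnit)
  refine ⟨Units.mk0 (u * a ^ m : K) (mul_ne_zero huK (pow_ne_zero _ haK)), fun v => ?_, ?_,
    fun v hv => ?_⟩
  · rw [Units.val_mk0, map_mul, map_pow, Real.log_mul ((map_ne_zero v).2 huK)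
      (pow_ne_zero _ ((map_ne_zero v).2 haK)), Real.log_pow]
    have h2 : (0 : ℝ) < v.mult := by exact_mod_cast v.mult_pos
    refine nonneg_of_mul_nonneg_right (a := (v.mult : ℝ)) ?_ h2
    calc 0 ≤ _ := key v
      _ = _ := by ring
  · rw [Units.val_mk0, map_mul, map_pow, hfin, one_mul]
    exact pow_lt_one₀ (apply_nonneg w _) ha1 hm0
  · rw [Units.val_mk0, map_mul, map_pow, hfin, one_mul, ha2 v hv, one_pow]

end FinitePlaces

/-! ### Galois action on `V_K`. -/

section GaloisAction

instance : Normal ℚ (AlgebraicClosure ℚ) :=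
  have h : IsAlgClosure ℚ (AlgebraicClosure ℚ) := by
    convert AlgebraicClosure.instIsAlgClosure ℚ
    · rfl
    · exact Subsingleton.elim _ _
  h.normal

variable {K : IntermediateField ℚ (AlgebraicClosure ℚ)}

theorem galAct_fieldClass_of_commutes (τ : AlgebraicClosure ℚ ≃ₐ[ℚ] AlgebraicClosure ℚ)
    (σ : K ≃ₐ[ℚ] K) (h : ∀ x : K, τ x = σ x) (a : Additive Kˣ) :
    galAct τ (fieldClass K a) =
      fieldClass K (Additive.ofMul (Units.map (σ : K →* K) (Additive.toMul a))) := by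
  change algClass _ = algClass _
  congr 1
  apply Additive.toMul.injective
  ext
  exact h _

theorem liftNormal_commutes_coe (σ : K ≃ₐ[ℚ] K) (x : K) :
    σ.liftNormal (AlgebraicClosure ℚ) x = σ x :=
  σ.liftNormal_commutes (AlgebraicClosure ℚ) x

/-- The action of `Gal(K/ℚ)` on `V_K`. -/
def fieldConj (σ : K ≃ₐ[ℚ] K) : fieldSpan K →ₗ[ℚ] fieldSpan K :=
  (galAct (σ.liftNormal (AlgebraicClosure ℚ))).toRatLinearMap.restrict (p := fieldSpan K)
    (q := fieldSpan K) <| by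
      intro x hx
      have : fieldSpan K ≤ (fieldSpan K).comap
          (galAct (σ.liftNormal (AlgebraicClosure ℚ))).toRatLinearMap := by
        refine Submodule.span_le.2 ?_
        rintro _ ⟨a, rfl⟩
        refine Submodule.subset_span ?_
        exact ⟨_, (galAct_fieldClass_of_commutes _ σ (liftNormal_commutes_coe σ) a).symm⟩
      exact this hx

theorem nsmul_galAct_of_commutes (τ : AlgebraicClosure ℚ ≃ₐ[ℚ] AlgebraicClosure ℚ)
    (σ : K ≃ₐ[ℚ] K) (h : ∀ x : K, τ x = σ x) {x : AlgModTor} {n : ℕ} {a : Additive Kˣ}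
    (hx : n • x = fieldClass K a) :
    n • galAct τ x =
      fieldClass K (Additive.ofMul (Units.map (σ : K →* K) (Additive.toMul a))) := by
  rw [← map_nsmul, hx, galAct_fieldClass_of_commutes τ σ h]

theorem nsmul_fieldConj (σ : K ≃ₐ[ℚ] K) {x : fieldSpan K} {n : ℕ} {a : Additive Kˣ}
    (hx : n • (x : AlgModTor) = fieldClass K a) :
    n • (fieldConj σ x : AlgModTor) =
      fieldClass K (Additive.ofMul (Units.map (σ : K →* K) (Additive.toMul a))) :=
  nsmul_galAct_of_commutes _ σ (liftNormal_commutes_coe σ) hx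

/-- On `V_K` only the restriction of `τ` to `K` matters: this is clear on classes of elements of
`K`, and torsion-freeness extends it to their roots. -/
theorem galAct_eq_fieldConj (τ : AlgebraicClosure ℚ ≃ₐ[ℚ] AlgebraicClosure ℚ) (σ : K ≃ₐ[ℚ] K)
    (h : ∀ x : K, τ x = σ x) (x : fieldSpan K) : galAct τ x = fieldConj σ x := by
  obtain ⟨n, a, hn, ha⟩ := exists_nsmul_eq_fieldClass x
  apply nsmul_right_injective hn
  exact (nsmul_galAct_of_commutes τ σ h ha).trans (nsmul_fieldConj σ ha).symm

theorem fieldConj_fieldConj (σ τ : K ≃ₐ[ℚ] K) (x : fieldSpan K) :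
    fieldConj σ (fieldConj τ x) = fieldConj (σ * τ) x := by
  obtain ⟨n, a, hn, ha⟩ := exists_nsmul_eq_fieldClass x
  apply Subtype.ext
  apply nsmul_right_injective hn
  exact (nsmul_fieldConj σ (nsmul_fieldConj τ ha)).trans (nsmul_fieldConj (σ * τ) ha).symm

theorem fieldConj_one (x : fieldSpan K) : fieldConj 1 x = x := by
  obtain ⟨n, a, hn, ha⟩ := exists_nsmul_eq_fieldClass x
  apply Subtype.ext
  apply nsmul_right_injective hn
  exact (nsmul_fieldConj 1 ha).trans ha.symm

/-- By normality automorphisms restrict to `K` and lift from it. The orbit is thus finite, so its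
`ncard` is a true count and not the default 0. -/
theorem range_galAct [Normal ℚ K] (x : fieldSpan K) :
    (Set.range fun τ : AlgebraicClosure ℚ ≃ₐ[ℚ] AlgebraicClosure ℚ => galAct τ x) =
      Set.range fun σ : K ≃ₐ[ℚ] K => (fieldConj σ x : AlgModTor) := by
  ext y
  constructor
  · rintro ⟨τ, rfl⟩
    exact ⟨τ.restrictNormal K, (galAct_eq_fieldConj τ _
      (fun x => (τ.restrictNormal_commutes K x).symm) x).symm⟩
  · rintro ⟨σ, rfl⟩
    exact ⟨σ.liftNormal _, rfl⟩

variable [NumberField K]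

theorem orbitSize_pos [Normal ℚ K] (x : fieldSpan K) : 0 < orbitSize (x : AlgModTor) := by
  rw [orbitSize, range_galAct, Set.ncard_pos (Set.finite_range _)]
  exact Set.range_nonempty _

/-- An equivariant map does not increase the size of Galois orbits. -/
theorem orbitSize_map_le [Normal ℚ K] (P : fieldSpan K → fieldSpan K)
    (hP : ∀ (σ : K ≃ₐ[ℚ] K) (x : fieldSpan K), P (fieldConj σ x) = fieldConj σ (P x))
    (x : fieldSpan K) : orbitSize (P x : AlgModTor) ≤ orbitSize (x : AlgModTor) := by
  have h : ∀ y : fieldSpan K, orbitSize (y : AlgModTor) =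
      (Set.range fun σ : K ≃ₐ[ℚ] K => fieldConj σ y).ncard := by
    intro y
    rw [orbitSize, range_galAct, ← Set.ncard_image_of_injective _ Subtype.val_injective,
      ← Set.range_comp]
    rfl
  rw [h, h]
  have : (Set.range fun σ : K ≃ₐ[ℚ] K => fieldConj σ (P x)) =
      P '' Set.range fun σ : K ≃ₐ[ℚ] K => fieldConj σ x := by
    rw [← Set.range_comp]
    exact congrArg Set.range (funext fun σ => (hP σ x).symm)
  rw [this]
  exact Set.ncard_image_le (Set.finite_range _)

theorem Place.logAbs_conj (σ : K ≃ₐ[ℚ] K) (v : Place K) (x : fieldSpan K) :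
    (v.conj σ).logAbs x = v.logAbs (fieldConj σ⁻¹ x) := by
  obtain ⟨n, a, hn, ha⟩ := exists_nsmul_eq_fieldClass x
  rw [Place.logAbs_eq _ hn ha, Place.logAbs_eq _ hn (nsmul_fieldConj σ⁻¹ ha), Place.logUnit_conj]

theorem isConjPlace_iff (u v : Place K) :
    IsConjPlace u v ↔ ∃ σ : K ≃ₐ[ℚ] K, u = v.conj σ := by
  refine exists_congr fun σ => ?_
  rw [← Place.abv_injective.eq_iff, DFunLike.ext_iff]
  simp only [Place.abv_conj]

end GaloisAction

/-! ### The Weil height as a Galois-invariant norm. -/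

section Height

variable {K : IntermediateField ℚ (AlgebraicClosure ℚ)} [NumberField K]

theorem finite_logAbs_ne_zero (x : fieldSpan K) : {v : Place K | v.logAbs x ≠ 0}.Finite := by
  obtain ⟨n, a, hn, ha⟩ := exists_nsmul_eq_fieldClass x
  refine (Place.finite_support_logUnit a).subset fun v hv h => hv ?_
  rw [Place.logAbs_eq v hn ha, h, zero_div]

/-- Kronecker's theorem modulo torsion; it gives the height its positivity. -/
theorem eq_zero_of_logAbs_eq_zero (x : fieldSpan K) (h : ∀ v : Place K, v.logAbs x = 0) :
    x = 0 := by
  obtain ⟨n, a, hn, ha⟩ := exists_nsmul_eq_fieldClass x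
  have h1 : IsOfFinOrder (Additive.toMul a) := by
    apply isOfFinOrder_of_logUnit_eq_zero
    intro v
    have := h v
    rw [Place.logAbs_eq v hn ha, div_eq_zero_iff] at this
    exact this.resolve_right (by exact_mod_cast hn)
  have h2 : fieldClass K a = 0 :=
    (algClass_eq_zero_iff _).2 ((Units.map (K.val : K →* AlgebraicClosure ℚ)).isOfFinOrder h1)
  rw [h2] at ha
  exact Subtype.ext ((smul_eq_zero.1 ha).resolve_left hn)

theorem finite_support_abs_logAbs (x : fieldSpan K) :
    (Function.support fun v : Place K => |v.logAbs x|).Finite :=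
  (finite_logAbs_ne_zero x).subset fun _ hv h => hv (abs_eq_zero.2 h)

theorem weilHeight_nonneg (x : fieldSpan K) : 0 ≤ weilHeight x :=
  finsum_nonneg fun _ => abs_nonneg _

theorem weilHeight_pos {x : fieldSpan K} (hx : x ≠ 0) : 0 < weilHeight x := by
  obtain ⟨v, hv⟩ : ∃ v : Place K, v.logAbs x ≠ 0 := by
    by_contra! h
    exact hx (eq_zero_of_logAbs_eq_zero x h)
  exact finsum_pos (fun _ => abs_nonneg _) ⟨v, abs_pos.2 hv⟩ (finite_support_abs_logAbs x)

theorem weilHeight_add_le (x y : fieldSpan K) :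
    weilHeight (x + y) ≤ weilHeight x + weilHeight y := by
  classical
  -- One finite set carrying all three supports turns the `finsum`s into comparable finite sums.
  let F := (finite_logAbs_ne_zero x).toFinset ∪ (finite_logAbs_ne_zero y).toFinset
  have hx : weilHeight x = ∑ v ∈ F, |v.logAbs x| :=
    finsum_eq_sum_of_support_subset _ fun v hv => by
      simp [F, abs_ne_zero.1 hv]
  have hy : weilHeight y = ∑ v ∈ F, |v.logAbs y| :=
    finsum_eq_sum_of_support_subset _ fun v hv => by
      simp [F, abs_ne_zero.1 hv]
  have hxy : weilHeight (x + y) = ∑ v ∈ F, |v.logAbs (x + y)| := by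
    refine finsum_eq_sum_of_support_subset _ fun v hv => ?_
    by_contra h
    simp only [F, Finset.coe_union, Set.Finite.coe_toFinset, Set.mem_union, Set.mem_ofPred_eq,
      not_or, not_not] at h
    exact abs_ne_zero.1 hv (by rw [map_add, h.1, h.2, add_zero])
  rw [hx, hy, hxy, ← Finset.sum_add_distrib]
  refine Finset.sum_le_sum fun v _ => ?_
  rw [map_add]
  exact abs_add_le _ _

theorem weilHeight_smul (r : ℚ) (x : fieldSpan K) :
    weilHeight (r • x) = |(r : ℝ)| * weilHeight x := by
  unfold weilHeight
  rw [← smul_eq_mul, smul_finsum]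
  simp only [map_smul, Rat.smul_def, abs_mul, smul_eq_mul]

theorem weilHeight_zero : weilHeight (0 : fieldSpan K) = 0 := by
  simp [weilHeight]

theorem weilHeight_sum_le {ι : Type*} (s : Finset ι) (f : ι → fieldSpan K) :
    weilHeight (∑ i ∈ s, f i) ≤ ∑ i ∈ s, weilHeight (f i) :=
  Finset.le_sum_of_subadditive _ weilHeight_zero.le weilHeight_add_le _ _

/-- Conjugation only permutes the terms of the height. -/
theorem weilHeight_fieldConj (σ : K ≃ₐ[ℚ] K) (x : fieldSpan K) :
    weilHeight (fieldConj σ x) = weilHeight x := by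
  unfold weilHeight
  rw [← finsum_comp_equiv (f := fun v : Place K => |v.logAbs x|) (Place.conjEquiv σ⁻¹)]
  refine finsum_congr fun v => ?_
  change _ = |(v.conj σ⁻¹).logAbs x|
  rw [Place.logAbs_conj, inv_inv]

theorem weilHeight_eq_sum (x : fieldSpan K) (F : Finset (FinitePlace K))
    (hF : ∀ u : FinitePlace K, Place.logAbs (Sum.inr u : Place K) x ≠ 0 → u ∈ F) :
    weilHeight x = ∑ v : InfinitePlace K, |Place.logAbs (Sum.inl v : Place K) x| +
      ∑ u ∈ F, |Place.logAbs (Sum.inr u : Place K) x| := by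
  rw [weilHeight, finsum_eq_sum_of_support_subset (s := Finset.univ.disjSum F),
    Finset.sum_disjSum]
  rintro (v | v) hv
  · simp
  · simpa using hF v (abs_ne_zero.1 hv)

/-- For a finite place `w` there is an element of `V_K` supported at `w` and the archimedean
places, with nonnegative archimedean logarithms, so that these sum up to the opposite of the
logarithm at `w`. -/
theorem exists_logAbs_single (w : FinitePlace K) :
    ∃ e : fieldSpan K, (∀ v : InfinitePlace K, 0 ≤ Place.logAbs (Sum.inl v : Place K) e) ∧
      Place.logAbs (Sum.inr w : Place K) e < 0 ∧
      (∀ u : FinitePlace K, u ≠ w → Place.logAbs (Sum.inr u : Place K) e = 0) ∧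
      ∑ v : InfinitePlace K, Place.logAbs (Sum.inl v : Place K) e =
        -Place.logAbs (Sum.inr w : Place K) e := by
  obtain ⟨a, h1, h2, h3⟩ := exists_unit_of_finitePlace w
  have hlog : ∀ v : Place K,
      v.logAbs ⟨fieldClass K (Additive.ofMul a), Submodule.subset_span ⟨_, rfl⟩⟩ =
        v.logUnit (Additive.ofMul a) := by
    intro v
    rw [v.logAbs_eq one_ne_zero (one_nsmul _), Nat.cast_one, div_one]
  have hn : (0 : ℝ) < Module.finrank ℚ K := Nat.cast_pos.2 Module.finrank_pos
  refine ⟨⟨fieldClass K (Additive.ofMul a), Submodule.subset_span ⟨_, rfl⟩⟩, ?_⟩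
  simp only [hlog]
  refine ⟨fun v => mul_nonneg (by positivity) (h1 v), ?_, fun u hu => ?_,
    Place.sum_logUnit_infinite _ w h3⟩
  · refine mul_neg_of_pos_of_neg (div_pos ?_ hn)
      (Real.log_neg (FinitePlace.pos_iff.2 a.ne_zero) h2)
    simp [Place.weight]
  · exact (Place.logUnit_eq_zero_iff _ _).2 (h3 u hu)

/-- Discreteness of the valuation puts all logarithms at `w` on one rational line. This is what
allows a `ℚ`-linear map to cancel the component at `w`. -/
theorem exists_logAbs_eq_ratCast_mul (w : FinitePlace K) :
    ∃ L : ℝ, ∀ x : fieldSpan K, ∃ r : ℚ, Place.logAbs (Sum.inr w : Place K) x = r * L := by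
  obtain ⟨L, hL⟩ := exists_log_eq_zmul w
  refine ⟨L, fun x => ?_⟩
  obtain ⟨n, a, hn, ha⟩ := exists_nsmul_eq_fieldClass x
  obtain ⟨k, hk⟩ := hL (Additive.toMul a : Kˣ)
  refine ⟨k / (Module.finrank ℚ K * n), ?_⟩
  rw [Place.logAbs_eq _ hn ha]
  change ((1 : ℕ) : ℝ) / _ * Real.log (w _) / n = _
  rw [hk]
  have hn : (0 : ℝ) < Module.finrank ℚ K := Nat.cast_pos.2 Module.finrank_pos
  push_cast
  field_simp

/-- The coefficient is a quotient of logarithms at `w`; being determined by the equation, it is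
automatically linear. -/
theorem exists_linearMap_ratCast_mul (w : FinitePlace K) (e : fieldSpan K)
    (he : Place.logAbs (Sum.inr w : Place K) e ≠ 0) :
    ∃ r : fieldSpan K →ₗ[ℚ] ℚ, ∀ x : fieldSpan K,
      (r x : ℝ) * Place.logAbs (Sum.inr w : Place K) e = Place.logAbs (Sum.inr w : Place K) x := by
  obtain ⟨L, hL⟩ := exists_logAbs_eq_ratCast_mul w
  have h : ∀ x : fieldSpan K, ∃ r : ℚ,
      (r : ℝ) * Place.logAbs (Sum.inr w : Place K) e = Place.logAbs (Sum.inr w : Place K) x := by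
    intro x
    obtain ⟨r, hr⟩ := hL x
    obtain ⟨s, hs⟩ := hL e
    have hs0 : (s : ℝ) ≠ 0 := left_ne_zero_of_mul (hs ▸ he)
    refine ⟨r / s, ?_⟩
    rw [hr, hs]
    push_cast
    field_simp
  choose r hr using h
  have hinj : ∀ {a b : ℚ}, (a : ℝ) * Place.logAbs (Sum.inr w : Place K) e =
      b * Place.logAbs (Sum.inr w : Place K) e → a = b := fun h =>
    Rat.cast_injective (mul_right_cancel₀ he h)
  refine ⟨⟨⟨r, fun x y => hinj ?_⟩, fun c x => hinj ?_⟩, hr⟩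
  · rw [hr, map_add, Rat.cast_add, add_mul, hr, hr]
  · rw [hr, map_smul, Rat.smul_def, RingHom.id_apply, smul_eq_mul, Rat.cast_mul, mul_assoc, hr]

end Height

/-! ### The projection, its Galois average and its norm. -/

section Projection

variable {K : IntermediateField ℚ (AlgebraicClosure ℚ)} [NumberField K]

/-- Removing the components at the places outside `S` yields a projection onto `V_{K,S}` that does
not increase the height. -/
theorem exists_projection (S : Set (Place K))
    (hS : ∀ v : InfinitePlace K, (Sum.inl v : Place K) ∈ S) :
    ∃ P : fieldSpan K →ₗ[ℚ] fieldSpan K, (∀ x, P x ∈ sUnitSpan S) ∧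
      (∀ x ∈ sUnitSpan S, P x = x) ∧ ∀ x, weilHeight (P x) ≤ weilHeight x := by
  classical
  choose e he0 he1 he2 he3 using exists_logAbs_single (K := K)
  choose r hr using fun w => exists_linearMap_ratCast_mul w (e w) (he1 w).ne
  have hr0 : ∀ w x, Place.logAbs (Sum.inr w : Place K) x = 0 → r w x = 0 := by
    intro w x h
    have := hr w x
    rw [h] at this
    exact_mod_cast (mul_eq_zero.1 this).resolve_right (he1 w).ne
  have hfin : ∀ x : fieldSpan K,
      {w : FinitePlace K | Place.logAbs (Sum.inr w : Place K) x ≠ 0}.Finite := fun x =>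
    (finite_logAbs_ne_zero x).preimage Sum.inr_injective.injOn
  -- `R x` lists the coefficients of the `e w` to be subtracted: only `w` outside `S` with nonzero
  -- logarithm of `x` contribute.
  let R : fieldSpan K →ₗ[ℚ] FinitePlace K →₀ ℚ :=
    { toFun := fun x => Finsupp.onFinset (hfin x).toFinset
        (fun w => if (Sum.inr w : Place K) ∈ S then 0 else r w x) fun w hw => by
          rw [Set.Finite.mem_toFinset]
          intro h
          rw [hr0 w x h, ite_self] at hw
          exact hw rfl
      map_add' := fun x y => by
        ext w
        simp only [Finsupp.onFinset_apply, Finsupp.add_apply, map_add]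
        split_ifs <;> simp
      map_smul' := fun c x => by
        ext w
        simp only [Finsupp.onFinset_apply, Finsupp.smul_apply, map_smul, RingHom.id_apply]
        split_ifs <;> simp }
  have hR : ∀ x w, R x w = if (Sum.inr w : Place K) ∈ S then 0 else r w x := fun x w => rfl
  let P : fieldSpan K →ₗ[ℚ] fieldSpan K := LinearMap.id - Finsupp.linearCombination ℚ e ∘ₗ R
  have hP : ∀ (x : fieldSpan K) (v : Place K),
      v.logAbs (P x) = v.logAbs x - ∑ w ∈ (hfin x).toFinset, (R x w : ℝ) * v.logAbs (e w) := by
    intro x v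
    change v.logAbs (x - Finsupp.linearCombination ℚ e (R x)) = _
    rw [map_sub, Finsupp.linearCombination_apply,
      Finsupp.sum_of_support_subset (s := (hfin x).toFinset), map_sum]
    · simp only [map_smul, Rat.smul_def]
    · intro w hw
      rw [Set.Finite.mem_toFinset]
      intro h
      rw [Finsupp.mem_support_iff, hR, hr0 w x h, ite_self] at hw
      exact hw rfl
    · exact fun _ _ => zero_smul _ _
  have hRe : ∀ (x : fieldSpan K) (w : FinitePlace K),
      (R x w : ℝ) * Place.logAbs (Sum.inr w : Place K) (e w) =
        if (Sum.inr w : Place K) ∈ S then 0 else Place.logAbs (Sum.inr w : Place K) x := by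
    intro x w
    rw [hR]
    split_ifs
    · rw [Rat.cast_zero, zero_mul]
    · exact hr w x
  have hPf : ∀ (x : fieldSpan K) (u : FinitePlace K),
      Place.logAbs (Sum.inr u : Place K) (P x) =
        if (Sum.inr u : Place K) ∈ S then Place.logAbs (Sum.inr u : Place K) x else 0 := by
    intro x u
    have h1 : ∑ w ∈ (hfin x).toFinset, (R x w : ℝ) * Place.logAbs (Sum.inr u : Place K) (e w) =
        if (Sum.inr u : Place K) ∈ S then 0 else Place.logAbs (Sum.inr u : Place K) x := by
      rw [Finset.sum_eq_single u, hRe]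
      · intro w _ hw
        rw [he2 w u hw.symm, mul_zero]
      · intro hu
        rw [Set.Finite.mem_toFinset, Set.mem_ofPred_eq, not_not] at hu
        rw [hR, hr0 u x hu, ite_self, Rat.cast_zero, zero_mul]
    rw [hP, h1]
    split_ifs <;> simp
  refine ⟨P, fun x => mem_sUnitSpan.2 ?_, fun x hx => ?_, fun x => ?_⟩
  · rintro (v | v) hv
    · exact absurd (hS v) hv
    · rw [hPf, if_neg hv]
  · have h : R x = 0 := by
      ext w
      rw [hR, Finsupp.zero_apply]
      split_ifs with hw
      · rfl
      · exact hr0 w x (mem_sUnitSpan.1 hx _ hw)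
    change x - Finsupp.linearCombination ℚ e (R x) = x
    rw [h, map_zero, sub_zero]
  · have hF : ∀ u : FinitePlace K, Place.logAbs (Sum.inr u : Place K) x ≠ 0 →
        u ∈ (hfin x).toFinset := fun u hu => (hfin x).mem_toFinset.2 hu
    rw [weilHeight_eq_sum x (hfin x).toFinset hF,
      weilHeight_eq_sum (P x) (hfin x).toFinset fun u hu => hF u fun h => hu (by
        rw [hPf, h, ite_self])]
    -- The mass added at infinity is bounded by the mass removed outside `S`: the archimedean
    -- logarithms of `e w` are nonnegative and sum to its mass at `w`.
    have h1 : ∑ v : InfinitePlace K, |Place.logAbs (Sum.inl v : Place K) (P x)| ≤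
        ∑ v : InfinitePlace K, |Place.logAbs (Sum.inl v : Place K) x| +
          ∑ w ∈ (hfin x).toFinset,
            |if (Sum.inr w : Place K) ∈ S then 0 else Place.logAbs (Sum.inr w : Place K) x| := by
      calc ∑ v : InfinitePlace K, |Place.logAbs (Sum.inl v : Place K) (P x)|
          ≤ ∑ v : InfinitePlace K, (|Place.logAbs (Sum.inl v : Place K) x| +
              ∑ w ∈ (hfin x).toFinset,
                |(R x w : ℝ)| * Place.logAbs (Sum.inl v : Place K) (e w)) := by
            refine Finset.sum_le_sum fun v _ => ?_
            rw [hP]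
            refine (abs_sub _ _).trans (add_le_add_right ?_ _)
            refine (Finset.abs_sum_le_sum_abs _ _).trans (Finset.sum_le_sum fun w _ => ?_)
            rw [abs_mul, abs_of_nonneg (he0 w v)]
        _ = _ := by
            rw [Finset.sum_add_distrib, Finset.sum_comm]
            congr 1
            refine Finset.sum_congr rfl fun w _ => ?_
            rw [← Finset.mul_sum, he3, ← abs_of_neg (he1 w), ← abs_mul, hRe]
    -- At each finite place the mass of `x` is either removed entirely or kept entirely.
    have h2 : ∀ w : FinitePlace K,
        |if (Sum.inr w : Place K) ∈ S then 0 else Place.logAbs (Sum.inr w : Place K) x| +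
          |Place.logAbs (Sum.inr w : Place K) (P x)| =
            |Place.logAbs (Sum.inr w : Place K) x| := by
      intro w
      rw [hPf]
      split_ifs <;> simp
    simp only [← h2, Finset.sum_add_distrib]
    linarith

/-- If `S` is stable under `Gal(K/ℚ)`, averaging over the Galois group makes the projection onto
`V_{K,S}` equivariant. -/
theorem exists_equivariant_projection (S : Set (Place K))
    (hS : ∀ v : InfinitePlace K, (Sum.inl v : Place K) ∈ S)
    (hconj : ∀ (σ : K ≃ₐ[ℚ] K) (v : Place K), v ∈ S → v.conj σ ∈ S) :
    ∃ P : fieldSpan K →ₗ[ℚ] fieldSpan K, (∀ x, P x ∈ sUnitSpan S) ∧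
      (∀ x ∈ sUnitSpan S, P x = x) ∧ (∀ x, weilHeight (P x) ≤ weilHeight x) ∧
      ∀ (σ : K ≃ₐ[ℚ] K) (x : fieldSpan K), P (fieldConj σ x) = fieldConj σ (P x) := by
  obtain ⟨Q, hQ1, hQ2, hQ3⟩ := exists_projection S hS
  -- Stability of `S` makes `V_{K,S}` Galois stable, so each conjugate of `Q` is again a projection
  -- onto it.
  have hmem : ∀ (σ : K ≃ₐ[ℚ] K), ∀ x ∈ sUnitSpan S, fieldConj σ x ∈ sUnitSpan S := by
    intro σ x hx
    refine mem_sUnitSpan.2 fun v hv => ?_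
    have h := Place.logAbs_conj σ⁻¹ v x
    rw [inv_inv] at h
    rw [← h]
    refine mem_sUnitSpan.1 hx _ fun h => hv ?_
    have := hconj σ _ h
    rwa [Place.conj_conj, mul_inv_cancel, Place.conj_one] at this
  let n : ℚ := Fintype.card (K ≃ₐ[ℚ] K)
  have hn : n ≠ 0 := Nat.cast_ne_zero.2 Fintype.card_ne_zero
  let P : fieldSpan K →ₗ[ℚ] fieldSpan K :=
    n⁻¹ • ∑ σ : K ≃ₐ[ℚ] K, fieldConj σ ∘ₗ Q ∘ₗ fieldConj σ⁻¹
  have hP : ∀ x, P x = n⁻¹ • ∑ σ : K ≃ₐ[ℚ] K, fieldConj σ (Q (fieldConj σ⁻¹ x)) := by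
    intro x
    simp [P, LinearMap.sum_apply]
  refine ⟨P, fun x => ?_, fun x hx => ?_, fun x => ?_, fun τ x => ?_⟩
  · rw [hP]
    exact Submodule.smul_mem _ _ (Submodule.sum_mem _ fun σ _ => hmem σ _ (hQ1 _))
  · have h : ∀ σ : K ≃ₐ[ℚ] K, fieldConj σ (Q (fieldConj σ⁻¹ x)) = x := by
      intro σ
      rw [hQ2 _ (hmem _ x hx), fieldConj_fieldConj, mul_inv_cancel, fieldConj_one]
    rw [hP, Finset.sum_congr rfl fun σ _ => h σ, Finset.sum_const, Finset.card_univ,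
      ← Nat.cast_smul_eq_nsmul ℚ, smul_smul, inv_mul_cancel₀ hn, one_smul]
  · have hn' : (0 : ℝ) < Fintype.card (K ≃ₐ[ℚ] K) := Nat.cast_pos.2 Fintype.card_pos
    rw [hP, weilHeight_smul]
    have h : ∀ σ : K ≃ₐ[ℚ] K, weilHeight (fieldConj σ (Q (fieldConj σ⁻¹ x))) ≤ weilHeight x := by
      intro σ
      rw [weilHeight_fieldConj]
      exact (hQ3 _).trans (weilHeight_fieldConj _ _).le
    have h1 := (weilHeight_sum_le Finset.univ
      fun σ : K ≃ₐ[ℚ] K => fieldConj σ (Q (fieldConj σ⁻¹ x))).trans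
        (Finset.sum_le_sum fun σ _ => h σ)
    rw [Finset.sum_const, Finset.card_univ, nsmul_eq_mul] at h1
    rw [Rat.cast_inv, Rat.cast_natCast, abs_inv, abs_of_pos hn', inv_mul_le_iff₀ hn']
    exact h1
  · rw [hP, hP, map_smul, map_sum]
    congr 1
    -- Replacing `σ` by `τ * σ` moves `τ` from the argument to the outside.
    rw [← Equiv.sum_comp (Equiv.mulLeft τ)]
    refine Finset.sum_congr rfl fun σ _ => ?_
    rw [Equiv.coe_mulLeft, mul_inv_rev, fieldConj_fieldConj, fieldConj_fieldConj, mul_assoc,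
      inv_mul_cancel, mul_one]

theorem conj_mem_placeSet (α : fieldSpan K) (σ : K ≃ₐ[ℚ] K) {v : Place K}
    (hv : v ∈ placeSet α) : v.conj σ ∈ placeSet α := by
  obtain ⟨w, hw, hvw⟩ := hv
  obtain ⟨τ, rfl⟩ := (isConjPlace_iff v w).1 hvw
  exact ⟨w, hw, (isConjPlace_iff _ _).2 ⟨σ * τ, Place.conj_conj σ τ w⟩⟩

/-- Finitely many places are conjugated by a finite group. -/
theorem finite_placeSet (α : fieldSpan K) : (placeSet α).Finite := by
  have h1 : {v : Place K | v.isLeft ∨ v.logAbs α ≠ 0}.Finite := by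
    refine ((Set.finite_range Sum.inl).union (finite_logAbs_ne_zero α)).subset ?_
    rintro (v | v) (h | h)
    · exact Or.inl ⟨v, rfl⟩
    · exact Or.inl ⟨v, rfl⟩
    · cases h
    · exact Or.inr h
  refine (Set.finite_iUnion fun σ : K ≃ₐ[ℚ] K => h1.image (Place.conj σ)).subset ?_
  rintro u ⟨v, hv, huv⟩
  obtain ⟨σ, rfl⟩ := (isConjPlace_iff u v).1 huv
  exact Set.mem_iUnion.2 ⟨σ, v, hv, rfl⟩

/-- A projection onto a nonzero subspace that does not increase `N` has norm one. -/
theorem isOperatorNorm_one {S : Set (Place K)} {N : fieldSpan K → ℝ}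
    {P : fieldSpan K →ₗ[ℚ] sUnitSpan S} (hP : ∀ x : sUnitSpan S, P (x : fieldSpan K) = x)
    (hle : ∀ x : fieldSpan K, N (P x : fieldSpan K) ≤ N x) (hpos : ∀ x ≠ 0, 0 < N x)
    (hS : sUnitSpan S ≠ ⊥) : IsOperatorNorm N P 1 := by
  refine ⟨⟨zero_le_one, fun x => by rw [one_mul]; exact hle x⟩, fun C hC => ?_⟩
  -- A nonzero fixed vector forces `C ≥ 1`.
  obtain ⟨x, hx, hx0⟩ := Submodule.exists_mem_ne_zero_of_ne_bot hS
  have h := hC.2 x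
  rw [hP ⟨x, hx⟩] at h
  exact le_of_mul_le_mul_right (by rwa [one_mul]) (hpos x hx0)

end Projection

theorem mainTheorem7 (K : IntermediateField ℚ (AlgebraicClosure ℚ)) [NumberField K]
    [IsGalois ℚ K] (α : fieldSpan K) :
    (placeSet α).Finite ∧
    (∀ v : InfinitePlace K, (Sum.inl v : Place K) ∈ placeSet α) ∧
    (∀ u v : Place K, v ∈ placeSet α → IsConjPlace u v → u ∈ placeSet α) ∧
    ∃ P : fieldSpan K →ₗ[ℚ] sUnitSpan (placeSet α),
      (∀ β : sUnitSpan (placeSet α), P (β : fieldSpan K) = β) ∧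
      (∀ β : fieldSpan K, weilHeight (P β : fieldSpan K) ≤ weilHeight β) ∧
      (∀ β : fieldSpan K,
        orbitSize ((P β : fieldSpan K) : AlgModTor) ≤ orbitSize (β : AlgModTor)) ∧
      (∀ β : fieldSpan K, mahlerHeight (P β : fieldSpan K) ≤ mahlerHeight β) ∧
      (sUnitSpan (placeSet α) ≠ ⊥ →
        IsOperatorNorm weilHeight P 1 ∧ IsOperatorNorm mahlerHeight P 1) := by
  have hinf : ∀ v : InfinitePlace K, (Sum.inl v : Place K) ∈ placeSet α := fun v =>
    ⟨Sum.inl v, Or.inl rfl, (isConjPlace_iff _ _).2 ⟨1, (Place.conj_one _).symm⟩⟩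
  obtain ⟨P, hP1, hP2, hP3, hP4⟩ := exists_equivariant_projection (placeSet α) hinf
    fun σ v hv => conj_mem_placeSet α σ hv
  have horb : ∀ β : fieldSpan K, orbitSize (P β : AlgModTor) ≤ orbitSize (β : AlgModTor) :=
    orbitSize_map_le P hP4
  have hmahler : ∀ β : fieldSpan K, mahlerHeight (P β) ≤ mahlerHeight β := fun β =>
    mul_le_mul (Nat.cast_le.2 (horb β)) (hP3 β) (weilHeight_nonneg _) (Nat.cast_nonneg _)
  have hproj : ∀ β : sUnitSpan (placeSet α), P.codRestrict _ hP1 (β : fieldSpan K) = β :=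
    fun β => Subtype.ext (hP2 β β.2)
  refine ⟨finite_placeSet α, hinf, fun u v hv huv => ?_, P.codRestrict _ hP1, hproj, hP3, horb,
    hmahler, fun hS => ⟨?_, ?_⟩⟩
  · obtain ⟨σ, rfl⟩ := (isConjPlace_iff u v).1 huv
    exact conj_mem_placeSet α σ hv
  · exact isOperatorNorm_one hproj hP3 (fun x hx => weilHeight_pos hx) hS
  · exact isOperatorNorm_one hproj hmahler
      (fun x hx => mul_pos (Nat.cast_pos.2 (orbitSize_pos x)) (weilHeight_pos hx)) hS

end
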